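/- Let $n$ be a natural number and let $\mathbb{F}$ be a field with $\operatorname{char}(\mathbb{F})\neq 2$ and $|\mathbb{F}|\geq n^2+1$ (possibly infinite). Let $M_n$ be the set of all $n\times n$ matrices over $\mathbb{F}$ and let $\Sigma_n=\{x\in M_n : x^t=x\}$ be the set of symmetric ones. Let $\alpha_1,\alpha_2$ be two distinct nonzero elements of $\mathbb{F}$, and let $\phi,\psi:\Sigma_n\to\Sigma_n$ be maps (not assumed linear), at least one of which is surjective, such that $$\det(\phi(x)+\alpha_i\psi(y))=\det(x+\alpha_i y)\qquad\text{for all } x,y\in\Sigma_n \text{ and } i=1,2.$$ Then $\phi=\psi$, and there exist $u\in M_n$ and $\beta\in\mathbb{F}$ with $\det(\beta u^2)=1$ such that $$\phi(x)=\beta\, u x u^t\qquad\text{for all } x\in\Sigma_n.$$ -/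

import Mathlib

/-- The set `Σ_n(F)` of symmetric `n × n` matrices over `F`, as a type. -/
abbrev SymMat (n : ℕ) (F : Type*) : Type _ :=
  {x : Matrix (Fin n) (Fin n) F // x.IsSymm}

/-! Absorb `α` into `ψ` and let `ψ` be surjective. The functions `x ↦ det (x + z)`, `z` symmetric,
span every `x ↦ tr (S x)` with `S` symmetric, so they separate symmetric matrices, and a curve is
affine as soon as all its `det (f t + z)` are. Since `det` is affine along lines in a direction of
rank at most one (a dyad), `φ` is affine along these lines, and its increments are again dyads
(`map_add_smul_dyad`, `isDyad_sub`). Pencils of dyads and injectivity of `φ` make the mixed second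
differences vanish (`map_add_dyad_add_dyad`); as dyads span, `φ = L + φ 0` with `L` linear,
preserving `det` and dyads, and `ψ = L - φ 0`.

With two scalars, `α₁ ψ(0) = -φ(0) = α₂ ψ(0)`, so both maps vanish at 0 and equal `L`. After a
congruence `L` scales each diagonal matrix unit; dyads then force it to act entrywise, and the image
of the all-ones matrix gives the factors. -/

namespace SymmDet

open Matrix

section

/-! ### Determinants along dyad lines. -/

variable {F : Type*} [Field F] {ι : Type*} [Fintype ι] [DecidableEq ι]

/-- A symmetric matrix of rank at most one: a scalar multiple of some `p pᵗ`. -/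
def IsDyad (A : Matrix ι ι F) : Prop :=
  ∃ (c : F) (p : ι → F), A = c • vecMulVec p p

/-- A function `F → F` of the form `t ↦ a + t b`. -/
def IsAffine (g : F → F) : Prop :=
  ∃ a b : F, ∀ t, g t = a + t * b

omit [Fintype ι] [DecidableEq ι] in
theorem IsDyad.isSymm {A : Matrix ι ι F} (h : IsDyad A) : A.IsSymm := by
  obtain ⟨c, p, rfl⟩ := h
  ext i j
  simp [vecMulVec_apply, mul_comm]

/-- The matrix is a Schur complement of a bordered matrix in which `t` enters only the last column,
affinely. -/
theorem isAffine_det_add_smul (y : Matrix ι ι F) {v : Matrix ι ι F} (hv : IsDyad v) :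
    IsAffine fun t : F => (y + t • v).det := by
  obtain ⟨c, p, rfl⟩ := hv
  let N : Matrix (ι ⊕ Unit) (ι ⊕ Unit) F :=
    fromBlocks y 0 (replicateRow Unit p) 1
  have key : ∀ t : F, (y + t • (c • vecMulVec p p)).det
      = (N.updateCol (Sum.inr ()) (Sum.elim (0 : ι → F) (1 : Unit → F) + t • Sum.elim (-(c • p)) (0 : Unit → F))).det := by
    intro t
    have : N.updateCol (Sum.inr ()) (Sum.elim (0 : ι → F) (1 : Unit → F) + t • Sum.elim (-(c • p)) (0 : Unit → F))
        = fromBlocks y (replicateCol Unit (-((t * c) • p))) (replicateRow Unit p) 1 := by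
      ext (i | i) (j | j) <;> simp [N, mul_assoc]
    rw [this, det_fromBlocks_one₂₂]
    congr 1
    ext i j
    simp [mul_apply, vecMulVec_apply, mul_assoc]
  refine ⟨(N.updateCol (Sum.inr ()) (Sum.elim (0 : ι → F) (1 : Unit → F))).det,
    (N.updateCol (Sum.inr ()) (Sum.elim (-(c • p)) (0 : Unit → F))).det, fun t => ?_⟩
  simp only [key t, det_updateCol_add, det_updateCol_smul]

/-! ### Trace functionals from determinants. -/

/-- The space of functions spanned by `x ↦ det (x + z)` for symmetric `z`. -/
def detSpan (F : Type*) [Field F] (ι : Type*) [Fintype ι] [DecidableEq ι] :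
    Submodule F (Matrix ι ι F → F) :=
  Submodule.span F {f | ∃ z : Matrix ι ι F, z.IsSymm ∧ f = fun x => (x + z).det}

open Polynomial in
theorem coeff_eq_sum_eval [DecidableEq F] (s : Finset F) {P : F[X]} (hP : P.degree < s.card) (k : ℕ) :
    P.coeff k = ∑ a ∈ s, (Lagrange.basis s id a).coeff k * P.eval a := by
  conv_lhs => rw [Lagrange.eq_interpolate (v := id) (Set.injOn_id _) hP, Lagrange.interpolate_apply,
    finsetSum_coeff]
  simp [mul_comm]

/-- The trace is a coefficient of the characteristic polynomial of `-(S * x)`, whose value at `a` is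
`det S * det (x + a S⁻¹)`; interpolation on `s` recovers it. -/
theorem trace_mem_detSpan_of_isUnit {s : Finset F} (hs : Fintype.card ι < s.card)
    {S : Matrix ι ι F} (hS : S.IsSymm) (hu : IsUnit S.det) :
    (fun x => (S * x).trace) ∈ detSpan F ι := by
  classical
  cases isEmpty_or_nonempty ι
  · convert (detSpan F ι).zero_mem
    simp [trace]
  have key : (fun x => (S * x).trace) = ∑ a ∈ s,
      ((Lagrange.basis s id a).coeff (Fintype.card ι - 1) * S.det) •
        (fun x : Matrix ι ι F => (x + a • S⁻¹).det) := by
    ext x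
    have h1 := trace_eq_neg_charpoly_coeff (-(S * x))
    have h2 : (S * x).trace = (-(S * x)).charpoly.coeff (Fintype.card ι - 1) := by
      rw [trace_neg] at h1
      exact neg_injective h1
    rw [h2, coeff_eq_sum_eval s (by rw [charpoly_degree_eq_dim]; exact_mod_cast hs)]
    simp only [Finset.sum_apply, Pi.smul_apply, smul_eq_mul]
    refine Finset.sum_congr rfl fun a _ => ?_
    rw [mul_assoc, ← det_mul, eval_charpoly, mul_add, Matrix.mul_smul, mul_nonsing_inv _ hu, add_comm,
      sub_neg_eq_add, scalar_apply, smul_one_eq_diagonal]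
  rw [key]
  refine Submodule.sum_mem _ fun a _ => Submodule.smul_mem _ _ (Submodule.subset_span ?_)
  refine ⟨_, ?_, rfl⟩
  rw [IsSymm, transpose_smul, transpose_nonsing_inv, hS.eq]

theorem trace_mem_detSpan {s : Finset F} (hs : Fintype.card ι < s.card)
    {S : Matrix ι ι F} (hS : S.IsSymm) :
    (fun x => (S * x).trace) ∈ detSpan F ι := by
  -- Shifting by a scalar matrix makes `S` invertible: a nonzero polynomial of degree `card ι`
  -- cannot vanish on all of `s`.
  obtain ⟨r, hr⟩ : ∃ r : F, (S + r • (1 : Matrix ι ι F)).det ≠ 0 := by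
    by_contra! h
    have h0 : (-S).charpoly = 0 := by
      refine Polynomial.eq_zero_of_degree_lt_of_eval_finset_eq_zero s
        (by rw [charpoly_degree_eq_dim]; exact_mod_cast hs) fun a _ => ?_
      rw [eval_charpoly, ← h a, scalar_apply, smul_one_eq_diagonal, sub_neg_eq_add, add_comm]
    exact (charpoly_monic (-S)).ne_zero h0
  have e : (fun x => (S * x).trace) = (fun x => ((S + r • (1 : Matrix ι ι F)) * x).trace)
      - r • (fun x : Matrix ι ι F => ((1 : Matrix ι ι F) * x).trace) := by
    ext x
    simp [add_mul]
  rw [e]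
  refine Submodule.sub_mem _ (trace_mem_detSpan_of_isUnit hs ?_ hr.isUnit)
    (Submodule.smul_mem _ _ (trace_mem_detSpan_of_isUnit hs isSymm_one (by simp)))
  exact hS.add (isSymm_one.smul r)

theorem eq_of_trace_mul_eq (h2 : (2 : F) ≠ 0) {x y : Matrix ι ι F} (hx : x.IsSymm) (hy : y.IsSymm)
    (h : ∀ S : Matrix ι ι F, S.IsSymm → (S * x).trace = (S * y).trace) : x = y := by
  ext i j
  have := h (single i j 1 + single j i 1)
    (by rw [IsSymm, transpose_add, transpose_single, transpose_single, add_comm])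
  simp only [add_mul, trace_add, trace_single_mul, one_smul] at this
  have hxx := hx.apply i j
  have hyy := hy.apply i j
  apply mul_left_cancel₀ h2
  grind

theorem eq_of_det_add_eq (h2 : (2 : F) ≠ 0) {s : Finset F} (hs : Fintype.card ι < s.card)
    {x y : Matrix ι ι F} (hx : x.IsSymm) (hy : y.IsSymm)
    (h : ∀ z : Matrix ι ι F, z.IsSymm → (x + z).det = (y + z).det) : x = y := by
  refine eq_of_trace_mul_eq h2 hx hy fun S hS => ?_
  refine Submodule.span_induction (p := fun f _ => f x = f y) ?_ rfl ?_ ?_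
    (trace_mem_detSpan hs hS)
  · rintro _ ⟨z, hz, rfl⟩
    exact h z hz
  · intro f g _ _ hf hg
    simp [hf, hg]
  · intro a f _ hf
    simp [hf]

theorem eq_add_smul_of_isAffine_det (h2 : (2 : F) ≠ 0) {s : Finset F}
    (hs : Fintype.card ι < s.card) {f : F → Matrix ι ι F} (hf : ∀ t, (f t).IsSymm)
    (h : ∀ z : Matrix ι ι F, z.IsSymm → IsAffine fun t => (f t + z).det) (t : F) :
    f t = f 0 + t • (f 1 - f 0) := by
  refine eq_of_trace_mul_eq h2 (hf t) ((hf 0).add (((hf 1).sub (hf 0)).smul t)) fun S hS => ?_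
  obtain ⟨a, b, hab⟩ : IsAffine fun t => (S * f t).trace := by
    refine Submodule.span_induction (p := fun g _ => IsAffine fun t => g (f t)) ?_ ?_ ?_ ?_
      (trace_mem_detSpan hs hS)
    · rintro _ ⟨z, hz, rfl⟩
      exact h z hz
    · exact ⟨0, 0, by simp⟩
    · rintro g g' _ _ ⟨a, b, hg⟩ ⟨a', b', hg'⟩
      exact ⟨a + a', b + b', fun t => by simp only [Pi.add_apply, hg, hg']; ring⟩
    · rintro c g _ ⟨a, b, hg⟩
      exact ⟨c * a, c * b, fun t => by simp only [Pi.smul_apply, smul_eq_mul, hg]; ring⟩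
  simp only [mul_add, Matrix.mul_smul, mul_sub, trace_add, trace_smul, trace_sub, hab, smul_eq_mul]
  ring

/-! ### Congruence diagonalisation and pencils of dyads. -/

theorem exists_eq_mul_diagonal_mul_transpose (h2 : (2 : F) ≠ 0) {A : Matrix ι ι F}
    (hA : A.IsSymm) :
    ∃ (g : Matrix ι ι F) (d : ι → F), IsUnit g.det ∧ A = g * diagonal d * gᵀ := by
  have : Invertible (2 : F) := invertibleOfNonzero h2
  obtain ⟨v, hv⟩ := LinearMap.BilinForm.exists_orthogonal_basis
    (B := A.toBilin') (LinearMap.BilinForm.isSymm_iff.1 (isSymm_toBilin'_iff_isSymm.2 hA))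
  let w : Module.Basis ι F (ι → F) :=
    v.reindex (Fintype.equivOfCardEq (by simp))
  let e := Pi.basisFun F ι
  have h1 := LinearMap.BilinForm.toMatrix_mul_basis_toMatrix e w A.toBilin'
  have h3 : LinearMap.BilinForm.toMatrix e A.toBilin' = A := by
    rw [LinearMap.BilinForm.toMatrix_basisFun, LinearMap.BilinForm.toMatrix'_toBilin']
  have h4 : LinearMap.BilinForm.toMatrix w A.toBilin'
      = diagonal fun i => A.toBilin' (w i) (w i) := by
    ext i j
    rw [LinearMap.BilinForm.toMatrix_apply, diagonal_apply]
    split_ifs with hij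
    · rw [hij]
    · simp only [w, Module.Basis.reindex_apply]
      exact hv fun h => hij ((Equiv.injective _) h)
  rw [h3, h4] at h1
  have hPQ : w.toMatrix e * e.toMatrix w = 1 := w.toMatrix_mul_toMatrix_flip e
  have hQP : e.toMatrix w * w.toMatrix e = 1 := e.toMatrix_mul_toMatrix_flip w
  refine ⟨(w.toMatrix e)ᵀ, fun i => A.toBilin' (w i) (w i), ?_, ?_⟩
  · rw [det_transpose]
    exact IsUnit.of_mul_eq_one _ (by rw [← det_mul, hPQ, det_one])
  · rw [← h1, transpose_transpose]
    have hQP' : (w.toMatrix e)ᵀ * (e.toMatrix w)ᵀ = 1 := by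
      rw [← transpose_mul, hQP, transpose_one]
    rw [← Matrix.mul_assoc, ← Matrix.mul_assoc, hQP', Matrix.one_mul, Matrix.mul_assoc, hQP,
      Matrix.mul_one]

open Polynomial in
-- For `A = g d gᵀ`, testing with `z = g gᵀ` gives `det(g)² ∏ (1 + t dᵢ)`, whose degree is the
-- number of nonzero `dᵢ`.
theorem isDyad_of_isAffine_det (h2 : (2 : F) ≠ 0) {s : Finset F}
    (hs : Fintype.card ι < s.card) {A : Matrix ι ι F} (hA : A.IsSymm)
    (h : ∀ z : Matrix ι ι F, z.IsSymm → IsAffine fun t : F => (z + t • A).det) : IsDyad A := by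
  classical
  obtain ⟨g, d, hg, rfl⟩ := exists_eq_mul_diagonal_mul_transpose h2 hA
  obtain ⟨a, b, hab⟩ := h (g * gᵀ) (by rw [IsSymm, transpose_mul, transpose_transpose])
  let P : F[X] := ∏ i, (C (d i) * X + 1)
  have hP : ∀ t, g.det * g.det * P.eval t = a + t * b := by
    intro t
    have e : g * gᵀ + t • (g * diagonal d * gᵀ) = g * (diagonal fun i => d i * t + 1) * gᵀ := by
      have : (diagonal fun i => d i * t + 1) = 1 + t • diagonal d := by
        ext i j
        by_cases hij : i = j
        · subst hij; simp; ring
        · simp [hij]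
      rw [this, mul_add, add_mul, Matrix.mul_one, Matrix.mul_smul, Matrix.smul_mul]
    rw [← hab t]
    simp only [e, det_mul, det_diagonal, det_transpose, P, eval_prod, eval_add, eval_mul, eval_C,
      eval_X, eval_one]
    ring
  have hdeg1 : ∀ i, (C (d i) * X + 1 : F[X]).natDegree = if d i = 0 then 0 else 1 := by
    intro i
    split_ifs with hi
    · simp [hi]
    · rw [← C_1]; exact natDegree_linear hi
  have hne : ∀ i, (C (d i) * X + 1 : F[X]) ≠ 0 := by
    intro i hi
    have := congrArg (eval 0) hi
    simp at this
  have hdeg : P.natDegree = (Finset.univ.filter fun i => d i ≠ 0).card := by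
    rw [natDegree_prod _ _ fun i _ => hne i]
    simp only [hdeg1, Finset.card_filter, ite_not]
  have hdet : g.det * g.det ≠ 0 := mul_ne_zero hg.ne_zero hg.ne_zero
  have hle : (Finset.univ.filter fun i => d i ≠ 0).card ≤ 1 := by
    cases isEmpty_or_nonempty ι
    · simp
    have hc : 1 ≤ Fintype.card ι := Fintype.card_pos
    have hd1 : (C (g.det * g.det) * P).natDegree ≤ Fintype.card ι := by
      refine (natDegree_C_mul_le _ _).trans ?_
      rw [hdeg]; exact Finset.card_le_univ _
    have hd2 : (C b * X + C a).natDegree ≤ 1 := natDegree_linear_le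
    have : C (g.det * g.det) * P = C b * X + C a := by
      refine eq_of_degrees_lt_of_eval_finset_eq s ?_ ?_ fun t _ => ?_
      · exact (degree_le_natDegree).trans_lt (by exact_mod_cast hd1.trans_lt hs)
      · exact (degree_le_natDegree).trans_lt (by exact_mod_cast (hd2.trans hc).trans_lt hs)
      · simp [hP t]; ring
    rw [← hdeg, ← natDegree_C_mul hdet, this]
    exact hd2
  by_cases h0 : ∃ i, d i ≠ 0
  · obtain ⟨i, hi⟩ := h0
    refine ⟨d i, g.col i, ?_⟩
    have hz : ∀ j, j ≠ i → d j = 0 := by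
      intro j hj
      by_contra hdj
      exact hj (Finset.card_le_one.1 hle j (by simp [hdj]) i (by simp [hi]))
    ext k l
    rw [mul_apply, Finset.sum_eq_single i]
    · simp [vecMulVec_apply]; ring
    · intro j _ hj
      simp [hz j hj]
    · simp
  · push Not at h0
    exact ⟨0, 0, by simp [show d = 0 from funext h0]⟩

omit [Fintype ι] [DecidableEq ι] in
theorem IsDyad.minor {A : Matrix ι ι F} (h : IsDyad A) (i j k l : ι) :
    A i j * A k l = A i l * A k j := by
  obtain ⟨c, p, rfl⟩ := h
  simp only [Matrix.smul_apply, vecMulVec_apply, smul_eq_mul]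
  ring

omit [Fintype ι] [DecidableEq ι] in
theorem exists_eq_smul_of_isDyad_pencil (h2 : (2 : F) ≠ 0) {M N : Matrix ι ι F}
    (h : ∀ t : F, IsDyad (M + t • N)) (hN : N ≠ 0) : ∃ m : F, M = m • N := by
  have hM : M.IsSymm := by simpa using (h 0).isSymm
  have hNs : N.IsSymm := by simpa using (h 1).isSymm.sub hM
  -- If the diagonal of `N` vanishes, the second difference in `t` of a principal minor identity
  -- gives `2 (N i j)² = 0`.
  obtain ⟨k, hk⟩ : ∃ k, N k k ≠ 0 := by
    by_contra! h0
    refine hN ?_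
    ext i j
    have e0 := (h 0).minor i i j j
    have e1 := (h 1).minor i i j j
    have e2 := (h (-1)).minor i i j j
    simp only [Matrix.add_apply, Matrix.smul_apply, smul_eq_mul, h0, hM.apply i j, hNs.apply i j] at e0 e1 e2
    have : 2 * (N i j) ^ 2 = 0 := by linear_combination 2 * e0 - e1 - e2
    simpa [h2] using this
  -- This `m` kills the `k k` entry of `D = M - m N`. Minors through `k k` then kill row and column
  -- `k`, and the part odd in `t` kills the rest.
  refine ⟨M k k / N k k, ?_⟩
  set m := M k k / N k k
  have hD : ∀ t : F, IsDyad ((M - m • N) + t • N) := by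
    intro t
    convert h (t - m) using 1
    rw [sub_smul]; abel
  set D := M - m • N
  have hDs : D.IsSymm := by simpa using (hD 0).isSymm
  have hDk : D k k = 0 := by simp [D, m, hk]
  have hDik : ∀ i, D i k = 0 := by
    intro i
    have := (hD 0).minor i i k k
    simp only [zero_smul, add_zero, hDk, mul_zero, ← hDs.apply k i] at this
    simpa using this.symm
  have hDki : ∀ i, D k i = 0 := fun i => by rw [hDs.apply i k, hDik]
  rw [← sub_eq_zero]
  ext i j
  have e1 := (hD 1).minor i j k k
  have e2 := (hD (-1)).minor i j k k
  simp only [Matrix.add_apply, Matrix.smul_apply, smul_eq_mul, hDk, hDik, hDki] at e1 e2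
  have : (2 * N k k) * D i j = 0 := by linear_combination e1 - e2
  exact (mul_eq_zero.1 this).resolve_left (mul_ne_zero h2 hk)

theorem symm_induction (h2 : (2 : F) ≠ 0) {P : Matrix ι ι F → Prop} (h0 : P 0)
    (hadd : ∀ x v : Matrix ι ι F, x.IsSymm → IsDyad v → P x → P (x + v))
    {x : Matrix ι ι F} (hx : x.IsSymm) : P x := by
  obtain ⟨g, d, -, rfl⟩ := exists_eq_mul_diagonal_mul_transpose h2 hx
  have e : g * diagonal d * gᵀ = ∑ i, d i • vecMulVec (g.col i) (g.col i) := by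
    ext k l
    rw [mul_apply, Matrix.sum_apply]
    refine Finset.sum_congr rfl fun i _ => ?_
    simp [vecMulVec_apply]; ring
  rw [e]
  have hd : ∀ i, IsDyad (d i • vecMulVec (g.col i) (g.col i)) := fun i => ⟨_, _, rfl⟩
  suffices ∀ s : Finset ι, (∑ i ∈ s, d i • vecMulVec (g.col i) (g.col i)).IsSymm ∧
      P (∑ i ∈ s, d i • vecMulVec (g.col i) (g.col i)) from (this _).2
  intro s
  induction s using Finset.induction_on with
  | empty => exact ⟨by simp [isSymm_zero], by simpa using h0⟩
  | insert i s hi ih =>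
    rw [Finset.sum_insert hi, add_comm]
    exact ⟨ih.1.add (hd i).isSymm, hadd _ _ ih.1 (hd i) ih.2⟩

/-! ### From preserved determinants to linearity. -/

/-- `φ` and `ψ` act on symmetric matrices, `ψ` maps onto them, and the pair preserves the
determinant of sums. -/
structure DetSumPair (φ ψ : Matrix ι ι F → Matrix ι ι F) : Prop where
  isSymm_left : ∀ x, x.IsSymm → (φ x).IsSymm
  isSymm_right : ∀ x, x.IsSymm → (ψ x).IsSymm
  surj : ∀ z, z.IsSymm → ∃ y, y.IsSymm ∧ ψ y = z
  det_add : ∀ x y, x.IsSymm → y.IsSymm → (φ x + ψ y).det = (x + y).det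

namespace DetSumPair

variable {φ ψ : Matrix ι ι F → Matrix ι ι F} {s : Finset F}

theorem injective (H : DetSumPair φ ψ) (h2 : (2 : F) ≠ 0) (hs : Fintype.card ι < s.card)
    {x y : Matrix ι ι F} (hx : x.IsSymm) (hy : y.IsSymm) (h : φ x = φ y) : x = y :=
  eq_of_det_add_eq h2 hs hx hy fun z hz => by
    rw [← H.det_add x z hx hz, ← H.det_add y z hy hz, h]

theorem map_add_smul_dyad (H : DetSumPair φ ψ) (h2 : (2 : F) ≠ 0) (hs : Fintype.card ι < s.card)
    {x v : Matrix ι ι F} (hx : x.IsSymm) (hv : IsDyad v) (t : F) :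
    φ (x + t • v) = φ x + t • (φ (x + v) - φ x) := by
  have := eq_add_smul_of_isAffine_det h2 hs (f := fun t => φ (x + t • v))
    (fun t => H.isSymm_left _ (hx.add (hv.isSymm.smul t))) ?_ t
  · simpa using this
  · intro z hz
    obtain ⟨y, hy, rfl⟩ := H.surj z hz
    obtain ⟨a, b, hab⟩ := isAffine_det_add_smul (x + y) hv
    refine ⟨a, b, fun t => ?_⟩
    rw [← hab t]
    simp only [H.det_add _ y (hx.add (hv.isSymm.smul t)) hy]
    rw [add_right_comm]

theorem isDyad_sub (H : DetSumPair φ ψ) (h2 : (2 : F) ≠ 0) (hs : Fintype.card ι < s.card)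
    {x v : Matrix ι ι F} (hx : x.IsSymm) (hv : IsDyad v) : IsDyad (φ (x + v) - φ x) := by
  have hφx := H.isSymm_left x hx
  refine isDyad_of_isAffine_det h2 hs ((H.isSymm_left _ (hx.add hv.isSymm)).sub hφx)
    fun z hz => ?_
  obtain ⟨y, hy, hyz⟩ := H.surj (z - φ x) (hz.sub hφx)
  obtain ⟨a, b, hab⟩ := isAffine_det_add_smul (x + y) hv
  refine ⟨a, b, fun t => ?_⟩
  rw [← hab t]
  have e : z + t • (φ (x + v) - φ x) = φ (x + t • v) + ψ y := by
    rw [H.map_add_smul_dyad h2 hs hx hv, hyz]; abel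
  simp only [e, H.det_add _ y (hx.add (hv.isSymm.smul t)) hy]
  rw [add_right_comm]

/-- If the mixed difference `C` is nonzero, both increments are multiples of `C`. Injectivity then
makes `v` and `w` proportional, and affineness along their common line gives `C = 0`. -/
theorem map_add_dyad_add_dyad (H : DetSumPair φ ψ) (h2 : (2 : F) ≠ 0)
    (hs : Fintype.card ι < s.card) {x v w : Matrix ι ι F} (hx : x.IsSymm) (hv : IsDyad v)
    (hw : IsDyad w) : φ (x + w + v) - φ (x + w) = φ (x + v) - φ x := by
  set C := (φ (x + w + v) - φ (x + w)) - (φ (x + v) - φ x) with hC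
  have hxw := hx.add hw.isSymm
  have hxv := hx.add hv.isSymm
  have mixed : ∀ {v w : Matrix ι ι F}, IsDyad v → IsDyad w → ∀ t : F,
      IsDyad ((φ (x + v) - φ x) +
        t • ((φ (x + w + v) - φ (x + w)) - (φ (x + v) - φ x))) := by
    intro v w hv hw t
    have := H.isDyad_sub h2 hs (hx.add (hw.isSymm.smul t)) hv
    rw [add_right_comm, H.map_add_smul_dyad h2 hs (hx.add hv.isSymm) hw,
      H.map_add_smul_dyad h2 hs hx hw] at this
    convert this using 1
    rw [add_right_comm x w v]
    module
  by_contra hne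
  have hC0 : C ≠ 0 := fun h => hne (sub_eq_zero.1 (hC ▸ h))
  obtain ⟨a, ha⟩ := exists_eq_smul_of_isDyad_pencil h2 (mixed hv hw) hC0
  obtain ⟨b, hb⟩ := exists_eq_smul_of_isDyad_pencil h2 (N := C) (fun t => by
    convert mixed hw hv t using 3
    rw [hC, add_right_comm x w v]; abel) hC0
  rw [← hC] at ha
  have hline : b • v = a • w := by
    have := H.injective h2 hs (hx.add (hv.isSymm.smul b)) (hx.add (hw.isSymm.smul a)) (by
      rw [H.map_add_smul_dyad h2 hs hx hv, H.map_add_smul_dyad h2 hs hx hw, ha, hb,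
        smul_smul, smul_smul, mul_comm])
    exact add_left_cancel this
  by_cases ha0 : a = 0
  · have hv0 : v = 0 := by
      rw [ha0, zero_smul, sub_eq_zero] at ha
      simpa using H.injective h2 hs hxv hx ha
    exact hne (by simp [hv0])
  · have hw' : w = (a⁻¹ * b) • v := by
      rw [mul_smul, hline, smul_smul, inv_mul_cancel₀ ha0, one_smul]
    refine hne ?_
    have e : x + w + v = x + (a⁻¹ * b + 1) • v := by rw [hw']; module
    rw [e, H.map_add_smul_dyad h2 hs hx hv, hw', H.map_add_smul_dyad h2 hs hx hv]
    module

theorem map_add_dyad (H : DetSumPair φ ψ) (h2 : (2 : F) ≠ 0) (hs : Fintype.card ι < s.card)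
    {x v : Matrix ι ι F} (hx : x.IsSymm) (hv : IsDyad v) :
    φ (x + v) - φ x = φ v - φ 0 := by
  refine symm_induction h2 (P := fun x => φ (x + v) - φ x = φ v - φ 0) (by simp) ?_ hx
  intro x w hx hw ih
  rw [H.map_add_dyad_add_dyad h2 hs hx hv hw, ih]

theorem map_add (H : DetSumPair φ ψ) (h2 : (2 : F) ≠ 0) (hs : Fintype.card ι < s.card)
    {x y : Matrix ι ι F} (hx : x.IsSymm) (hy : y.IsSymm) :
    φ (x + y) - φ 0 = (φ x - φ 0) + (φ y - φ 0) := by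
  refine symm_induction h2 (P := fun y => φ (x + y) - φ 0 = (φ x - φ 0) + (φ y - φ 0))
    (by simp) ?_ hy
  intro y v hy hv ih
  have e1 := H.map_add_dyad h2 hs (hx.add hy) hv
  have e2 := H.map_add_dyad h2 hs hy hv
  rw [← add_assoc, ← sub_add_sub_cancel _ (φ (x + y)), e1, ih, ← e2]
  abel

theorem map_smul (H : DetSumPair φ ψ) (h2 : (2 : F) ≠ 0) (hs : Fintype.card ι < s.card)
    {x : Matrix ι ι F} (hx : x.IsSymm) (t : F) :
    φ (t • x) - φ 0 = t • (φ x - φ 0) := by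
  refine symm_induction h2 (P := fun x => φ (t • x) - φ 0 = t • (φ x - φ 0)) (by simp) ?_ hx
  intro x v hx hv ih
  have hv' : φ (t • v) - φ 0 = t • (φ v - φ 0) := by
    have := H.map_add_smul_dyad h2 hs isSymm_zero hv t
    simp only [zero_add] at this
    rw [this]; abel
  rw [smul_add, H.map_add h2 hs (hx.smul t) (hv.isSymm.smul t), ih, hv',
    H.map_add h2 hs hx hv.isSymm, smul_add]

open Polynomial in
theorem _root_.SymmDet.det_eq_det_of_det_add_smul {s : Finset F} (hs : Fintype.card ι < s.card)
    {A B A' B' : Matrix ι ι F} (h : ∀ t : F, (t • A + B).det = (t • A' + B').det) :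
    A.det = A'.det := by
  have hdeg : ∀ A B : Matrix ι ι F,
      (det ((X : F[X]) • A.map C + B.map C)).degree < s.card := fun A B =>
    degree_le_natDegree.trans_lt
      (by exact_mod_cast (natDegree_det_X_add_C_le A B).trans_lt hs)
  have heval : ∀ (A B : Matrix ι ι F) (t : F),
      (det ((X : F[X]) • A.map C + B.map C)).eval t = (t • A + B).det := by
    intro A B t
    rw [eval_det]
    congr 1
    ext i j
    simp [mul_comm]
  have := eq_of_degrees_lt_of_eval_finset_eq s (hdeg A B) (hdeg A' B') fun t _ => by
    rw [heval, heval, h]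
  rw [← coeff_det_X_add_C_card A B, this, coeff_det_X_add_C_card]

theorem exists_linear (H : DetSumPair φ ψ) (h2 : (2 : F) ≠ 0) (hs : Fintype.card ι < s.card) :
    ∃ L : Matrix ι ι F →ₗ[F] Matrix ι ι F,
      (∀ v, IsDyad v → IsDyad (L v)) ∧ (∀ x, x.IsSymm → (L x).det = x.det) ∧
      (∀ x, x.IsSymm → φ x = L x + φ 0) ∧ (∀ x, x.IsSymm → ψ x = L x - φ 0) := by
  have hsymm : ∀ x : Matrix ι ι F, (x + xᵀ).IsSymm := fun x => isSymm_add_transpose_self x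
  -- Symmetrising first makes `L` linear on all matrices.
  let L : Matrix ι ι F →ₗ[F] Matrix ι ι F :=
    { toFun := fun x => (2 : F)⁻¹ • (φ (x + xᵀ) - φ 0)
      map_add' := fun x y => by
        have : (x + y) + (x + y)ᵀ = (x + xᵀ) + (y + yᵀ) := by
          rw [transpose_add]; abel
        rw [this, H.map_add h2 hs (hsymm x) (hsymm y), smul_add]
      map_smul' := fun t x => by
        rw [transpose_smul, ← smul_add, H.map_smul h2 hs (hsymm x), RingHom.id_apply, smul_comm] }
  have hL : ∀ x, x.IsSymm → L x = φ x - φ 0 := by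
    intro x hx
    change (2 : F)⁻¹ • (φ (x + xᵀ) - φ 0) = _
    rw [hx.eq, ← two_smul F x, H.map_smul h2 hs hx, inv_smul_smul₀ h2]
  have hφ : ∀ x, x.IsSymm → φ x = L x + φ 0 := fun x hx => by rw [hL x hx]; abel
  have hφ0 := H.isSymm_left 0 isSymm_zero
  have hLs : ∀ x, x.IsSymm → (L x).IsSymm := fun x hx => by
    rw [hL x hx]; exact (H.isSymm_left x hx).sub hφ0
  have hdet : ∀ x, x.IsSymm → (L x).det = x.det := by
    intro x hx
    -- Compare leading coefficients in `t`: the constant `φ 0 + ψ 0` does not affect them.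
    refine det_eq_det_of_det_add_smul hs (B := φ 0 + ψ 0) (B' := 0) fun t => ?_
    rw [← H.det_add _ 0 (hx.smul t) isSymm_zero, hφ _ (hx.smul t), _root_.map_smul, add_assoc]
  refine ⟨L, fun v hv => ?_, hdet, hφ, fun y hy => ?_⟩
  · rw [hL v hv.isSymm]
    simpa using H.isDyad_sub h2 hs isSymm_zero hv
  · let S : Submodule F (Matrix ι ι F) :=
      { carrier := {x | x.IsSymm}
        add_mem' := fun hx hy => hx.add hy
        zero_mem' := isSymm_zero
        smul_mem' := fun t _ hx => hx.smul t }
    let R : S →ₗ[F] S := L.restrict (p := S) (q := S) hLs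
    have hinj : Function.Injective R := by
      intro x y hxy
      have : L x.1 = L y.1 := congrArg Subtype.val hxy
      refine Subtype.ext (H.injective h2 hs x.2 y.2 ?_)
      rw [hφ _ x.2, hφ _ y.2, this]
    have hsurj : Function.Surjective R := LinearMap.injective_iff_surjective.1 hinj
    refine eq_of_det_add_eq h2 hs (H.isSymm_right y hy) ((hLs y hy).sub hφ0) fun z hz => ?_
    obtain ⟨x, hx⟩ := hsurj ⟨z - φ 0, hz.sub hφ0⟩
    have hx' : L x.1 = z - φ 0 := congrArg Subtype.val hx
    have hz' : z = φ x.1 := by rw [hφ _ x.2, hx']; abel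
    have e : L y - φ 0 + z = L (x.1 + y) := by rw [_root_.map_add, hx']; abel
    rw [e, hdet _ (x.2.add hy), ← H.det_add _ _ x.2 hy, hz', add_comm]

end DetSumPair

/-! ### Linear maps preserving dyads. -/

omit [Fintype ι] in
theorem apply_single_add_single_eq_zero (h2 : (2 : F) ≠ 0)
    {r : F} (hr0 : r ≠ 0) (hr1 : r ^ 2 ≠ 1) {M : Matrix ι ι F} {a b : F} (ha : a ≠ 0) (hb : b ≠ 0)
    {i j : ι} (hij : i ≠ j)
    (h : ∀ t : F, IsDyad (single i i a + t • M + t ^ 2 • single j j b))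
    {k l : ι} (h1 : ¬(k = i ∧ l = j)) (h1' : ¬(k = j ∧ l = i)) : M k l = 0 := by
  have hM : M.IsSymm := by
    have h0 := (h 0).isSymm
    have h1 := (h 1).isSymm
    ext k l
    have e1 := h1.apply l k
    simp only [Matrix.add_apply, Matrix.smul_apply, smul_eq_mul, single_apply] at e1
    rw [transpose_apply]
    grind
  have hout : ∀ k l, k ≠ i → k ≠ j → M k l = 0 := by
    intro k l hki hkj
    have hkk : M k k = 0 := by
      have e1 := (h 1).minor k k i i
      have e2 := (h (-1)).minor k k i i
      simp only [Matrix.add_apply, Matrix.smul_apply, smul_eq_mul, single_apply, hki.symm, hkj.symm,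
        hij.symm, hM.apply i k, and_self, and_true, and_false,
        if_true, if_false] at e1 e2
      have : (2 * a) * M k k = 0 := by linear_combination e1 - e2
      simpa [h2, ha] using this
    have e1 := (h 1).minor k k l l
    simp only [Matrix.add_apply, Matrix.smul_apply, smul_eq_mul, single_apply, hki.symm, hkj.symm,
      hM.apply k l, hkk, and_false, false_and, if_false] at e1
    simpa using e1.symm
  by_cases hk : k = i ∨ k = j
  · by_cases hl : l = i ∨ l = j
    · have e1 := (h 1).minor i i j j
      have e2 := (h (-1)).minor i i j j
      -- The minor has unknown coefficients at `t`, `t²` and `t³`, so a third nonzero point besides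
      -- `±1` is needed.
      have e3 := (h r).minor i i j j
      simp only [Matrix.add_apply, Matrix.smul_apply, smul_eq_mul, single_apply, hij, hij.symm,
        hM.apply i j, and_self, and_true, and_false, if_true, if_false] at e1 e2 e3
      have f1 : a * M j j + b * M i i = 0 := by
        have : 2 * (a * M j j + b * M i i) = 0 := by linear_combination e1 - e2
        simpa [h2] using this
      have f2 : 2 * (a * b + M i i * M j j - M i j ^ 2) = 0 := by linear_combination e1 + e2
      have f2' : a * b + M i i * M j j - M i j ^ 2 = 0 := by simpa [h2] using f2
      have f3 : r * (r ^ 2 - 1) * (b * M i i) = 0 := by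
        linear_combination e3 - r ^ 2 * f2' - r * f1
      have f4 : M i i = 0 := by
        simpa [hr0, sub_ne_zero.2 hr1, hb] using f3
      have f5 : M j j = 0 := by simpa [f4, ha] using f1
      rcases hk with rfl | rfl <;> rcases hl with rfl | rfl
      · exact f4
      · exact absurd ⟨rfl, rfl⟩ h1
      · exact absurd ⟨rfl, rfl⟩ h1'
      · exact f5
    · push Not at hl
      rw [hM.apply l k]
      exact hout l k hl.1 hl.2
  · push Not at hk
    exact hout k l hk.1 hk.2

theorem exists_eq_smul_diagonal_mul_mul_diagonal (h2 : (2 : F) ≠ 0) {s : Finset F}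
    (hs : Fintype.card ι ^ 2 < s.card) {L : Matrix ι ι F →ₗ[F] Matrix ι ι F}
    (hL : ∀ v, IsDyad v → IsDyad (L v)) {c : ι → F} (hc : ∀ i, c i ≠ 0)
    (hLc : ∀ i, L (single i i 1) = single i i (c i)) :
    ∃ (b : F) (v : ι → F), ∀ x : Matrix ι ι F, x.IsSymm →
      L x = b • (diagonal v * x * diagonal v) := by
  classical
  have hsupp : ∀ i j k l, ¬(k = i ∧ l = j) → ¬(k = j ∧ l = i) →
      L (single i j 1 + single j i 1) k l = 0 := by
    intro i j k l h h'
    by_cases hij : i = j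
    · subst hij
      rw [_root_.map_add, hLc, Matrix.add_apply, single_apply, if_neg (by grind), add_zero]
    -- Here the quadratic bound matters: two distinct indices give `s.card > 4`, which excludes the
    -- field of three elements.
    · obtain ⟨r, hr, hr'⟩ : ∃ r ∈ s, r ∉ ({0, 1, -1} : Finset F) := by
        have h3 : ({0, 1, -1} : Finset F).card ≤ 3 := Finset.card_le_three
        have hcard : 2 ≤ Fintype.card ι := by
          have := Fintype.one_lt_card_iff.2 ⟨i, j, hij⟩
          omega
        have : 2 ^ 2 ≤ Fintype.card ι ^ 2 := Nat.pow_le_pow_left hcard 2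
        exact Finset.exists_mem_notMem_of_card_lt_card (by omega)
      simp only [Finset.mem_insert, Finset.mem_singleton, not_or] at hr'
      refine apply_single_add_single_eq_zero h2 hr'.1 (by simp [sq_eq_one_iff, hr'])
        (hc i) (hc j) hij (fun t => ?_) h h'
      convert hL (vecMulVec (Pi.single i 1 + t • Pi.single j 1) (Pi.single i 1 + t • Pi.single j 1))
        ⟨1, _, by rw [one_smul]⟩ using 1
      have e : vecMulVec (Pi.single i (1 : F) + t • Pi.single j 1)
          (Pi.single i (1 : F) + t • Pi.single j 1)
          = single i i 1 + t • (single i j 1 + single j i 1) + t ^ 2 • single j j 1 := by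
        simp only [vecMulVec_add, add_vecMulVec, smul_vecMulVec, vecMulVec_smul,
          ← single_eq_single_vecMulVec_single]
        module
      rw [e, _root_.map_add L (_ + _), _root_.map_add L (single i i 1), _root_.map_smul,
        _root_.map_smul, hLc, hLc, smul_single]
  have hzero : ∀ (x : Matrix ι ι F) (k l : ι), x.IsSymm → x k l = 0 → L x k l = 0 := by
    intro x k l hx hkl
    have e : x = (2 : F)⁻¹ • ∑ i, ∑ j, x i j • (single i j 1 + single j i 1) := by
      have e1 : ∑ i, ∑ j, x i j • (single i j (1 : F)) = x := by
        conv_rhs => rw [matrix_eq_sum_single x]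
        simp
      have e2 : ∑ i, ∑ j, x i j • (single j i (1 : F)) = x := by
        rw [Finset.sum_comm]
        conv_rhs => rw [← e1]
        simp only [fun i j => hx.apply i j]
      simp only [smul_add, Finset.sum_add_distrib, e1, e2]
      rw [← smul_add, ← two_smul F x, inv_smul_smul₀ h2]
    rw [e, _root_.map_smul, map_sum, Matrix.smul_apply, Matrix.sum_apply, Finset.sum_eq_zero, smul_zero]
    intro i _
    rw [map_sum, Matrix.sum_apply, Finset.sum_eq_zero]
    intro j _
    rw [_root_.map_smul, Matrix.smul_apply, smul_eq_mul]
    by_cases h : k = i ∧ l = j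
    · rw [← h.1, ← h.2, hkl, zero_mul]
    by_cases h' : k = j ∧ l = i
    · rw [← h'.1, ← h'.2, ← hx.apply, hkl, zero_mul]
    rw [hsupp i j k l h h', mul_zero]
  -- `L x k l` depends only on `x k l`, so the all-ones matrix determines every factor.
  obtain ⟨b, v, hbv⟩ := hL (vecMulVec 1 1) ⟨1, 1, by rw [one_smul]⟩
  refine ⟨b, v, fun x hx => ?_⟩
  have hJ : (vecMulVec (1 : ι → F) 1).IsSymm := by ext; simp [vecMulVec_apply]
  ext k l
  have := hzero (x - x k l • vecMulVec 1 1) k l (hx.sub (hJ.smul _)) (by simp)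
  rw [_root_.map_sub, _root_.map_smul, hbv, Matrix.sub_apply, sub_eq_zero] at this
  rw [this]
  simp [vecMulVec_apply]
  ring

theorem exists_eq_smul_mul_mul_transpose (h2 : (2 : F) ≠ 0) {s : Finset F}
    (hs : Fintype.card ι ^ 2 < s.card) {L : Matrix ι ι F →ₗ[F] Matrix ι ι F}
    (hL : ∀ v, IsDyad v → IsDyad (L v)) (hdet : (L 1).det = 1) :
    ∃ (u : Matrix ι ι F) (β : F), (β • u ^ 2).det = 1 ∧
      ∀ x : Matrix ι ι F, x.IsSymm → L x = β • (u * x * uᵀ) := by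
  have hsingle : ∀ i : ι, IsDyad (single i i (1 : F)) := fun i =>
    ⟨1, Pi.single i 1, by rw [← single_eq_single_vecMulVec_single, one_smul]⟩
  choose c q hcq using fun i => hL _ (hsingle i)
  let w : Matrix ι ι F := of fun k i => q i k
  have hcw : ∀ i, L (single i i 1) = w * single i i (c i) * wᵀ := by
    intro i
    rw [hcq]
    have : single i i (c i) = c i • vecMulVec (Pi.single i 1) (Pi.single i 1) := by
      rw [← single_eq_single_vecMulVec_single, smul_single, smul_eq_mul, mul_one]
    rw [this, Matrix.mul_smul, Matrix.smul_mul, mul_vecMulVec, vecMulVec_mul, vecMul_transpose,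
      mulVec_single_one]
    rfl
  have hL1 : L 1 = w * diagonal c * wᵀ := by
    rw [← sum_single_eq_diagonal, Finset.mul_sum, Finset.sum_mul, ← diagonal_one,
      ← sum_single_eq_diagonal, map_sum]
    exact Finset.sum_congr rfl fun i _ => hcw i
  have hprod := hdet
  rw [hL1, det_mul, det_mul, det_transpose, det_diagonal] at hprod
  have hw : IsUnit w.det := IsUnit.of_mul_eq_one ((∏ i, c i) * w.det) (by rw [← hprod]; ring)
  have hc : ∀ i, c i ≠ 0 := by
    intro i hi
    rw [Finset.prod_eq_zero (Finset.mem_univ i) hi] at hprod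
    simp at hprod
  have hwT : wᵀ * (w⁻¹)ᵀ = 1 := by
    rw [← transpose_mul, nonsing_inv_mul _ hw, transpose_one]
  have hwT' : (w⁻¹)ᵀ * wᵀ = 1 := by
    rw [← transpose_mul, mul_nonsing_inv _ hw, transpose_one]
  -- The congruence by `w⁻¹` turns `L (single i i 1)` into `single i i (c i)`; `w` is invertible
  -- because `det (L 1) = 1`.
  let L' : Matrix ι ι F →ₗ[F] Matrix ι ι F :=
    LinearMap.mulRight F (w⁻¹)ᵀ ∘ₗ LinearMap.mulLeft F w⁻¹ ∘ₗ L
  have hL' : ∀ x, L' x = w⁻¹ * L x * (w⁻¹)ᵀ := fun x => rfl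
  obtain ⟨b, v, hbv⟩ := exists_eq_smul_diagonal_mul_mul_diagonal h2 hs (L := L') (c := c)
    (fun p hp => by
      obtain ⟨a, y, hay⟩ := hL p hp
      refine ⟨a, w⁻¹ *ᵥ y, ?_⟩
      rw [hL', hay, Matrix.mul_smul, Matrix.smul_mul, mul_vecMulVec, vecMulVec_mul,
        vecMul_transpose]) hc
    (fun i => by
      rw [hL', hcw, Matrix.mul_assoc, Matrix.mul_assoc, hwT, Matrix.mul_one, ← Matrix.mul_assoc,
        nonsing_inv_mul _ hw, Matrix.one_mul])
  have hform : ∀ x : Matrix ι ι F, x.IsSymm →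
      L x = b • ((w * diagonal v) * x * (w * diagonal v)ᵀ) := by
    intro x hx
    have e : L x = w * L' x * wᵀ := by
      rw [hL', Matrix.mul_assoc, Matrix.mul_assoc, hwT', Matrix.mul_one, ← Matrix.mul_assoc,
        mul_nonsing_inv _ hw, Matrix.one_mul]
    rw [e, hbv x hx, transpose_mul, diagonal_transpose, Matrix.mul_smul, Matrix.smul_mul]
    simp only [Matrix.mul_assoc]
  refine ⟨w * diagonal v, b, ?_, hform⟩
  rw [← hdet, hform 1 isSymm_one, Matrix.mul_one]
  simp only [det_smul, det_mul, det_transpose, sq]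

end

/-! ### Using both scalars. -/

variable {F : Type*} [Field F] {n : ℕ}

open Classical in
/-- The extension by zero of a map of symmetric matrices to all matrices. -/
noncomputable def extendZero (φ : SymMat n F → SymMat n F) (x : Matrix (Fin n) (Fin n) F) :
    Matrix (Fin n) (Fin n) F :=
  if h : x.IsSymm then (φ ⟨x, h⟩).1 else 0

theorem extendZero_of_isSymm (φ : SymMat n F → SymMat n F) {x : Matrix (Fin n) (Fin n) F}
    (h : x.IsSymm) : extendZero φ x = (φ ⟨x, h⟩).1 :=
  dif_pos h

theorem detSumPair_extendZero {φ ψ : SymMat n F → SymMat n F} (hψ : Function.Surjective ψ)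
    {α : F} (hα : α ≠ 0)
    (h : ∀ x y : SymMat n F, ((φ x).1 + α • (ψ y).1).det = (x.1 + α • y.1).det) :
    DetSumPair (extendZero φ) fun x => α • extendZero ψ (α⁻¹ • x) where
  isSymm_left x hx := by rw [extendZero_of_isSymm φ hx]; exact (φ _).2
  isSymm_right x hx := by
    rw [extendZero_of_isSymm ψ (hx.smul α⁻¹)]; exact (ψ _).2.smul α
  surj z hz := by
    obtain ⟨y, hy⟩ := hψ ⟨α⁻¹ • z, hz.smul _⟩
    refine ⟨α • y.1, y.2.smul α, ?_⟩
    simp only [inv_smul_smul₀ hα]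
    rw [extendZero_of_isSymm ψ y.2, hy, smul_inv_smul₀ hα]
  det_add x y hx hy := by
    rw [extendZero_of_isSymm φ hx, extendZero_of_isSymm ψ (hy.smul α⁻¹), h, smul_inv_smul₀ hα]

theorem eq_and_exists_of_surjective_right (h2 : (2 : F) ≠ 0) {s : Finset F}
    (hs : n ^ 2 < s.card) {α₁ α₂ : F} (hα₁ : α₁ ≠ 0) (hα₂ : α₂ ≠ 0) (hne : α₁ ≠ α₂)
    {φ ψ : SymMat n F → SymMat n F} (hψ : Function.Surjective ψ)
    (h₁ : ∀ x y : SymMat n F, ((φ x).1 + α₁ • (ψ y).1).det = (x.1 + α₁ • y.1).det)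
    (h₂ : ∀ x y : SymMat n F, ((φ x).1 + α₂ • (ψ y).1).det = (x.1 + α₂ • y.1).det) :
    φ = ψ ∧ ∃ (u : Matrix (Fin n) (Fin n) F) (β : F), (β • u ^ 2).det = 1 ∧
      ∀ x : SymMat n F, (φ x).1 = β • (u * x.1 * u.transpose) := by
  have hs' : Fintype.card (Fin n) ^ 2 < s.card := by simpa using hs
  have hs1 : Fintype.card (Fin n) < s.card := (Nat.le_self_pow two_ne_zero _).trans_lt hs'
  obtain ⟨L, hdyad, hdet, hφ, hψ₁⟩ := (detSumPair_extendZero hψ hα₁ h₁).exists_linear h2 hs1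
  obtain ⟨L', -, -, -, hψ₂⟩ := (detSumPair_extendZero hψ hα₂ h₂).exists_linear h2 hs1
  have hψ0 : extendZero ψ 0 = 0 := by
    have e1 := hψ₁ 0 isSymm_zero
    have e2 := hψ₂ 0 isSymm_zero
    simp only [smul_zero, _root_.map_zero] at e1 e2
    have : (α₁ - α₂) • extendZero ψ 0 = 0 := by rw [sub_smul, e1, e2, sub_self]
    exact (smul_eq_zero.1 this).resolve_left (sub_ne_zero.2 hne)
  have hφ0 : extendZero φ 0 = 0 := by
    have e1 := hψ₁ 0 isSymm_zero
    simpa [hψ0] using e1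
  have hφL : ∀ x : SymMat n F, (φ x).1 = L x.1 := fun x => by
    rw [← extendZero_of_isSymm φ x.2, hφ _ x.2, hφ0, add_zero]
  have hψL : ∀ x : SymMat n F, (ψ x).1 = L x.1 := fun x => by
    have := hψ₁ (α₁ • x.1) (x.2.smul α₁)
    simp only [inv_smul_smul₀ hα₁, hφ0, sub_zero, _root_.map_smul] at this
    rw [← extendZero_of_isSymm ψ x.2]
    exact smul_right_injective _ hα₁ this
  refine ⟨funext fun x => Subtype.ext (by rw [hφL, hψL]), ?_⟩
  obtain ⟨u, β, hu, hL⟩ := exists_eq_smul_mul_mul_transpose h2 hs' hdyad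
    (by rw [hdet 1 isSymm_one, det_one])
  exact ⟨u, β, hu, fun x => by rw [hφL, hL _ x.2]⟩

/-- Factoring out `α⁻¹` exchanges `φ` and `ψ`, which covers the case where `φ` is the surjective
map. -/
theorem det_add_inv_smul_comm {φ ψ : SymMat n F → SymMat n F} {α : F} (hα : α ≠ 0)
    (h : ∀ x y : SymMat n F, ((φ x).1 + α • (ψ y).1).det = (x.1 + α • y.1).det)
    (x y : SymMat n F) : ((ψ x).1 + α⁻¹ • (φ y).1).det = (x.1 + α⁻¹ • y.1).det := by
  have e : ∀ a b : Matrix (Fin n) (Fin n) F, a + α⁻¹ • b = α⁻¹ • (b + α • a) := fun a b => by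
    rw [smul_add, inv_smul_smul₀ hα, add_comm]
  rw [e, e, det_smul, det_smul, h]

end SymmDet

theorem mainTheorem4 {F : Type*} [Field F] (n : ℕ)
    (hchar : ringChar F ≠ 2)
    (hcard : ((n ^ 2 + 1 : ℕ) : Cardinal) ≤ Cardinal.mk F)
    (α₁ α₂ : F) (hα₁ : α₁ ≠ 0) (hα₂ : α₂ ≠ 0) (hne : α₁ ≠ α₂)
    (φ ψ : SymMat n F → SymMat n F)
    (hsurj : Function.Surjective φ ∨ Function.Surjective ψ)
    (h₁ : ∀ x y : SymMat n F,
      ((φ x).1 + α₁ • (ψ y).1).det = (x.1 + α₁ • y.1).det)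
    (h₂ : ∀ x y : SymMat n F,
      ((φ x).1 + α₂ • (ψ y).1).det = (x.1 + α₂ • y.1).det) :
    φ = ψ ∧
      ∃ (u : Matrix (Fin n) (Fin n) F) (β : F),
        (β • u ^ 2).det = 1 ∧
          ∀ x : SymMat n F, (φ x).1 = β • (u * x.1 * u.transpose) := by
  have h2 : (2 : F) ≠ 0 := Ring.two_ne_zero hchar
  obtain ⟨s, hs⟩ := Cardinal.exists_finset_le_card F _ hcard
  rcases hsurj with hφ | hψ
  · obtain ⟨e, u, β, hu, hψ⟩ := SymmDet.eq_and_exists_of_surjective_right h2 hs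
      (inv_ne_zero hα₁) (inv_ne_zero hα₂) (inv_injective.ne hne) hφ
      (SymmDet.det_add_inv_smul_comm hα₁ h₁) (SymmDet.det_add_inv_smul_comm hα₂ h₂)
    exact ⟨e.symm, u, β, hu, e ▸ hψ⟩
  · exact SymmDet.eq_and_exists_of_surjective_right h2 hs hα₁ hα₂ hne hψ h₁ h₂
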